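/- Let $X_1,X_2,\dots$ be a sequence of $\mathbb{R}^d$-valued random vectors on a probability space $(\Omega,\mathbb F,P)$, with partial sums $S_n:=X_1+\dots+X_n$, let $A_1,A_2,\dots$ be linear operators on $\mathbb{R}^d$ and $b_1,b_2,\dots$ vectors in $\mathbb{R}^d$, and let $\mu$ be a Borel probability measure on $\mathbb{R}^d$ that is full, i.e. whose support is contained in no proper affine subspace of $\mathbb{R}^d$. For sub-$\sigma$-fields $\mathcal A,\mathcal B$ of $\mathbb F$ put $\alpha(\mathcal A,\mathcal B):=\sup\{|P(A\cap B)-P(A)P(B)|: A\in\mathcal A,\ B\in\mathcal B\}$. Assume that (i) the sequence $(X_k)$ is strongly mixing, i.e. $\sup_{j\ge1}\alpha\big(\sigma(X_k,\,1\le k\le j),\,\sigma(X_k,\,k\ge j+n)\big)\to0$ as $n\to\infty$; (ii) the triangular array $(A_nX_j:1\le j\le n,\ n\ge1)$ is infinitesimal, i.e. $\max_{1\le j\le n}P(\|A_nX_j\|\ge\varepsilon)\to0$ as $n\to\infty$ for every $\varepsilon>0$; (iii) $A_nS_n+b_n$ converges in distribution to $\mu$ as $n\to\infty$; and that every $A_n$,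 $n\ge1$, is invertible. Then $$\sup\{\|A_nA_m^{-1}\|: n\in\mathbb{N},\ 1\le m\le n\}<\infty .$$ Moreover, whenever $(m_n)_{n\ge1}$ is a sequence of integers with $1\le m_n\le n$ for all $n$, every limit point $D$ of the sequence $(A_nA_{m_n}^{-1})_{n\ge1}$ belongs to the Urbanik decomposability semigroup $\mathbf D(\mu)$ of $\mu$, i.e. there is a Borel probability measure $\nu$ on $\mathbb{R}^d$ with $\mu=D\mu*\nu$, where $D\mu$ is the image of $\mu$ under $D$ and $*$ is convolution (equivalently, $X\stackrel{d}{=}DX+Y$ for independent random vectors $X$, $Y$ such that $X$ has law $\mu$). -/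

import Mathlib

open MeasureTheory ProbabilityTheory Filter Topology
open scoped ENNReal

namespace OpSelfdec

/-- The measure of dependence
`α(𝒜, ℬ) = sup {|P(A ∩ B) - P(A) P(B)| : A ∈ 𝒜, B ∈ ℬ}` between two σ-fields. -/
noncomputable def alphaDep {Ω : Type*} {m0 : MeasurableSpace Ω} (P : Measure Ω)
    (𝒜 ℬ : MeasurableSpace Ω) : ℝ :=
  sSup {r : ℝ | ∃ A B : Set Ω, MeasurableSet[𝒜] A ∧ MeasurableSet[ℬ] B ∧
    r = |P.real (A ∩ B) - P.real A * P.real B|}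

/-- The σ-field `σ(X_k, k ∈ s)` generated by the random vectors `X_k`, `k ∈ s`. -/
abbrev sigmaGen {Ω E : Type*} [MeasurableSpace E] (X : ℕ → Ω → E) (s : Set ℕ) :
    MeasurableSpace Ω :=
  ⨆ k ∈ s, MeasurableSpace.comap (X k) inferInstance

/-- The dependence coefficient
`α(X; n) = sup_{j ≥ 1} α(σ(X_k, 1 ≤ k ≤ j), σ(X_k, k ≥ j + n))` of a sequence `X_1, X_2, …`
(the term `X 0` is not used). -/
noncomputable def alphaCoeff {Ω E : Type*} {m0 : MeasurableSpace Ω} [MeasurableSpace E]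
    (P : Measure Ω) (X : ℕ → Ω → E) (n : ℕ) : ℝ :=
  sSup {r : ℝ | ∃ j : ℕ, 1 ≤ j ∧
    r = alphaDep P (sigmaGen X (Set.Icc 1 j)) (sigmaGen X (Set.Ici (j + n)))}

/-- The sequence `X_1, X_2, …` is strongly mixing: `α(X; n) → 0`. -/
def StronglyMixing {Ω E : Type*} {m0 : MeasurableSpace Ω} [MeasurableSpace E]
    (P : Measure Ω) (X : ℕ → Ω → E) : Prop :=
  Tendsto (alphaCoeff P X) atTop (𝓝 0)

/-- The triangular array `(Y_{n,j} : 1 ≤ j ≤ n, n ≥ 1)` is infinitesimal: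
for all `ε > 0`, `sup_{1 ≤ j ≤ n} P(‖Y_{n,j}‖ ≥ ε) → 0` as `n → ∞`. -/
def IsInfinitesimal {Ω E : Type*} {m0 : MeasurableSpace Ω} [Norm E]
    (P : Measure Ω) (Y : ℕ → ℕ → Ω → E) : Prop :=
  ∀ ε : ℝ, 0 < ε →
    Tendsto (fun n : ℕ => ⨆ j ∈ Set.Icc 1 n, P {ω | ε ≤ ‖Y n j ω‖}) atTop (𝓝 (0 : ℝ≥0∞))

/-- A measure is full if its support is contained in no proper hyperplane, a hyperplane being
a translate of a linear subspace (of any dimension). -/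
def IsFull {E : Type*} [NormedAddCommGroup E] [NormedSpace ℝ E] [MeasurableSpace E]
    (μ : Measure E) : Prop :=
  ∀ H : AffineSubspace ℝ E, μ.support ⊆ (H : Set E) → H = ⊤

/-- The Urbanik decomposability semigroup `D(μ)`: the operators `A` such that
`μ = Aμ ∗ ν` for some probability measure `ν`. -/
def decompSemigroup {E : Type*} [NormedAddCommGroup E] [NormedSpace ℝ E] [MeasurableSpace E]
    (μ : Measure E) : Set (E →L[ℝ] E) :=
  {A | ∃ ν : Measure E, IsProbabilityMeasure ν ∧ μ = Measure.conv (μ.map A) ν}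

/-- In terms of random vectors: `A ∈ D(μ)` iff there are independent random vectors `X`, `Y`
such that `X` has law `μ` and `AX + Y` has the same distribution as `X`. -/
theorem mem_decompSemigroup_iff {E : Type} [NormedAddCommGroup E] [NormedSpace ℝ E]
    [MeasurableSpace E] [BorelSpace E] [SecondCountableTopology E]
    (μ : Measure E) [IsProbabilityMeasure μ] (A : E →L[ℝ] E) :
    A ∈ decompSemigroup μ ↔
      ∃ (Ω : Type) (_ : MeasurableSpace Ω) (P : Measure Ω) (X Y : Ω → E),
        IsProbabilityMeasure P ∧ Measurable X ∧ Measurable Y ∧ P.map X = μ ∧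
        IndepFun X Y P ∧ IdentDistrib X (fun ω => A (X ω) + Y ω) P P := by
  constructor
  · rintro ⟨ν, hν, h⟩
    refine ⟨E × E, inferInstance, μ.prod ν, Prod.fst, Prod.snd, inferInstance,
      measurable_fst, measurable_snd, by simp, ?_, ?_⟩
    · exact indepFun_prod (X := id) (Y := id) measurable_id measurable_id
    · refine ⟨by fun_prop, by fun_prop, ?_⟩
      have hi : IndepFun (fun p : E × E => A p.1) (fun p : E × E => p.2) (μ.prod ν) :=
        indepFun_prod (X := A) (Y := id) A.measurable measurable_id
      have h2 := hi.map_add_eq_map_conv_map (by fun_prop) (by fun_prop)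
      have h3 : (μ.prod ν).map (fun p : E × E => A p.1) = μ.map A := by
        rw [show (fun p : E × E => A p.1) = A ∘ Prod.fst from rfl,
          ← Measure.map_map A.measurable measurable_fst]
        simp
      have h4 : (μ.prod ν).map (fun p : E × E => p.2) = ν := by
        simp
      rw [h3, h4, ← h] at h2
      have h5 : (μ.prod ν).map Prod.fst = μ := by simp
      rw [h5]
      exact h2.symm
  · rintro ⟨Ω, _, P, X, Y, hP, hX, hY, rfl, hXY, hid⟩
    refine ⟨P.map Y, Measure.isProbabilityMeasure_map hY.aemeasurable, ?_⟩
    have hi : IndepFun (fun ω => A (X ω)) Y P := hXY.comp A.measurable measurable_id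
    have h2 := hi.map_add_eq_map_conv_map (A.measurable.comp hX) hY
    rw [Measure.map_map A.measurable hX]
    exact hid.map_eq.trans h2

end OpSelfdec

/-! Write `Z_n = A_n S_n + b_n`, with characteristic function `φ_n`, and `D = A_n A_m⁻¹`. Then `Z_n
= D Z_m + Y`, where up to a constant `Y` is `A_n (S_n - S_m)`. Deleting a fixed number `q` of
summands after time `m` costs little by infinitesimality. The blocks that remain are separated by a
gap `q`, so mixing nearly decouples them. Hence `φ_n(L) ≈ φ_m(L ∘ D) ψ(L)`, with `ψ` the
characteristic function of `Y`, uniformly in `m ≤ n` and in bounded `L`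
(`StronglyMixing.exists_norm_charFunDual_sub_mul_charFunDual_le`).

Fullness enters through one fact: for a full law, `|φ(t L)|` is not identically `1` in `t` when `L ≠
0`. By compactness of the dual sphere, `Z_n` cannot degenerate along unit functionals
(`IsFull.not_forall_tendsto_norm_charFunDual`). This forces `A_n → 0`, which settles the case of
bounded `m`.

Boundedness: if `‖D‖ → ∞`, choose functionals `u → 0` for which `u ∘ D` has fixed norm. Then `φ_n(u)
→ 1` forces `|φ_m(u ∘ D)| → 1`, a degeneration of `Z_m`. Limit points: for bounded `D` the laws of
`Y` are tight, and passing to the limit in the factorisation gives `μ = Dμ ∗ ν`. Ultrafilters take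
the place of subsequences throughout. -/

namespace OpSelfdec

/-! ### Covariance inequalities for strong mixing coefficients -/

section Covariance

variable {Ω : Type*} {m 𝒜 ℬ : MeasurableSpace Ω} {m0 : MeasurableSpace Ω}

/-- If two finite measures differ by at most `a` on a sub-σ-field, then so do the integrals of
`[0, 1]`-valued functions measurable with respect to that σ-field. -/
lemma abs_integral_sub_le_of_measureReal (hm : m ≤ m0)
    {Q₁ Q₂ : Measure Ω} [IsFiniteMeasure Q₁] [IsFiniteMeasure Q₂] {a : ℝ}
    (h : ∀ G, MeasurableSet[m] G → |Q₁.real G - Q₂.real G| ≤ a)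
    {g : Ω → ℝ} (hg : Measurable[m] g) (h0 : ∀ ω, 0 ≤ g ω) (h1 : ∀ ω, g ω ≤ 1) :
    |∫ ω, g ω ∂Q₁ - ∫ ω, g ω ∂Q₂| ≤ a := by
  have hg' : Measurable g := hg.mono hm le_rfl
  have hint (Q : Measure Ω) [IsFiniteMeasure Q] : Integrable g Q :=
    Integrable.of_bound hg'.aestronglyMeasurable 1
      (ae_of_all _ fun ω => by rw [Real.norm_eq_abs, abs_of_nonneg (h0 ω)]; exact h1 ω)
  have hanti (Q : Measure Ω) [IsFiniteMeasure Q] :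
      Antitone fun t : ℝ => Q.real {ω | t ≤ g ω} := fun s t hst =>
    measureReal_mono fun ω (hω : t ≤ g ω) => hst.trans hω
  have hI (Q : Measure Ω) [IsFiniteMeasure Q] :
      IntegrableOn (fun t : ℝ => Q.real {ω | t ≤ g ω}) (Set.Ioc 0 1) :=
    Measure.integrableOn_of_bounded (M := Q.real Set.univ) (by simp)
      (hanti Q).measurable.aestronglyMeasurable
      (ae_of_all _ fun t => by
        rw [Real.norm_eq_abs, abs_of_nonneg measureReal_nonneg]
        exact measureReal_mono (Set.subset_univ _))
  -- Layer cake: `∫ g` is the integral over `t ∈ (0, 1]` of the mass of `{t ≤ g}`, and these sets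
  -- lie in the sub-σ-field.
  rw [(hint Q₁).integral_eq_integral_Ioc_meas_le (ae_of_all _ h0) (ae_of_all _ h1),
    (hint Q₂).integral_eq_integral_Ioc_meas_le (ae_of_all _ h0) (ae_of_all _ h1),
    ← integral_sub (hI Q₁) (hI Q₂)]
  have := norm_setIntegral_le_of_norm_le_const (μ := volume) (s := Set.Ioc (0 : ℝ) 1)
    (f := fun t : ℝ => Q₁.real {ω | t ≤ g ω} - Q₂.real {ω | t ≤ g ω}) (C := a) (by simp)
    (fun t _ => h _ (hg measurableSet_Ici))
  simpa using this

variable {P : Measure Ω} [IsProbabilityMeasure P]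

lemma abs_measureReal_inter_sub_mul_le_one (A B : Set Ω) :
    |P.real (A ∩ B) - P.real A * P.real B| ≤ 1 := by
  have h1 : P.real (A ∩ B) ≤ 1 := measureReal_le_one
  have h2 : P.real A ≤ 1 := measureReal_le_one
  have h3 : P.real B ≤ 1 := measureReal_le_one
  have h4 : 0 ≤ P.real (A ∩ B) := measureReal_nonneg
  have h5 : 0 ≤ P.real A := measureReal_nonneg
  have h6 : 0 ≤ P.real B := measureReal_nonneg
  rw [abs_le]
  constructor <;> nlinarith

lemma abs_measureReal_inter_sub_mul_le_alphaDep {A B : Set Ω} (hA : MeasurableSet[𝒜] A)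
    (hB : MeasurableSet[ℬ] B) :
    |P.real (A ∩ B) - P.real A * P.real B| ≤ alphaDep P 𝒜 ℬ := by
  refine le_csSup ⟨1, ?_⟩ ⟨A, B, hA, hB, rfl⟩
  rintro _ ⟨A, B, -, -, rfl⟩
  exact abs_measureReal_inter_sub_mul_le_one A B

lemma alphaDep_le_one : alphaDep P 𝒜 ℬ ≤ 1 := by
  refine csSup_le ⟨_, ∅, ∅, @MeasurableSet.empty _ 𝒜, @MeasurableSet.empty _ ℬ, rfl⟩ ?_
  rintro _ ⟨A, B, -, -, rfl⟩
  exact abs_measureReal_inter_sub_mul_le_one A B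

lemma alphaDep_le_alphaCoeff {E : Type*} [MeasurableSpace E] (X : ℕ → Ω → E) {j : ℕ}
    (hj : 1 ≤ j) (n : ℕ) :
    alphaDep P (sigmaGen X (Set.Icc 1 j)) (sigmaGen X (Set.Ici (j + n))) ≤ alphaCoeff P X n := by
  refine le_csSup ⟨1, ?_⟩ ⟨j, hj, rfl⟩
  rintro _ ⟨j, -, rfl⟩
  exact alphaDep_le_one

/-- The covariance inequality for `[0, 1]`-valued random variables. -/
lemma abs_integral_mul_sub_le_alphaDep_of_mem_Icc (h𝒜 : 𝒜 ≤ m0) (hℬ : ℬ ≤ m0) {f g : Ω → ℝ}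
    (hf : Measurable[𝒜] f) (hg : Measurable[ℬ] g) (f0 : ∀ ω, 0 ≤ f ω) (f1 : ∀ ω, f ω ≤ 1)
    (g0 : ∀ ω, 0 ≤ g ω) (g1 : ∀ ω, g ω ≤ 1) :
    |∫ ω, f ω * g ω ∂P - (∫ ω, f ω ∂P) * ∫ ω, g ω ∂P| ≤ alphaDep P 𝒜 ℬ := by
  have hf' : Measurable f := hf.mono h𝒜 le_rfl
  have hg' : Measurable g := hg.mono hℬ le_rfl
  have hfi : Integrable f P := Integrable.of_bound hf'.aestronglyMeasurable 1
    (ae_of_all _ fun ω => by rw [Real.norm_eq_abs, abs_of_nonneg (f0 ω)]; exact f1 ω)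
  -- Events are replaced by functions one factor at a time: here `f` against a fixed `B`, then `g`
  -- against the measure with density `f`.
  have hset : ∀ B, MeasurableSet[ℬ] B →
      |∫ ω in B, f ω ∂P - (∫ ω, f ω ∂P) * P.real B| ≤ alphaDep P 𝒜 ℬ := by
    intro B hB
    have := Measure.smul_finite P (measure_ne_top P B)
    have key := abs_integral_sub_le_of_measureReal h𝒜 (Q₁ := P.restrict B)
      (Q₂ := (P B) • P) (a := alphaDep P 𝒜 ℬ) ?_ hf f0 f1
    · rw [integral_smul_measure, smul_eq_mul] at key
      rwa [mul_comm]
    · intro A hA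
      rw [measureReal_restrict_apply (h𝒜 _ hA), measureReal_ennreal_smul_apply, mul_comm]
      exact abs_measureReal_inter_sub_mul_le_alphaDep hA hB
  let Q : Measure Ω := P.withDensity fun ω => ENNReal.ofReal (f ω)
  have hQ : IsFiniteMeasure Q := isFiniteMeasure_withDensity_ofReal hfi.2
  have hQB : ∀ B, MeasurableSet B → Q.real B = ∫ ω in B, f ω ∂P := by
    intro B hB
    rw [measureReal_def, withDensity_apply _ hB,
      integral_eq_lintegral_of_nonneg_ae (ae_of_all _ f0) hf'.aestronglyMeasurable]
  have := Measure.smul_finite P (ENNReal.ofReal_ne_top (r := ∫ ω, f ω ∂P))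
  have key := abs_integral_sub_le_of_measureReal hℬ (Q₁ := Q)
    (Q₂ := (ENNReal.ofReal (∫ ω, f ω ∂P)) • P) (a := alphaDep P 𝒜 ℬ) ?_ hg g0 g1
  · rw [integral_smul_measure, smul_eq_mul,
      ENNReal.toReal_ofReal (integral_nonneg f0)] at key
    convert key using 3
    rw [integral_withDensity_eq_integral_toReal_smul (by fun_prop) (ae_of_all _ (by simp))]
    simp [ENNReal.toReal_ofReal, f0]
  · intro B hB
    rw [hQB B (hℬ _ hB), measureReal_ennreal_smul_apply, ENNReal.toReal_ofReal (integral_nonneg f0)]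
    exact hset B hB

/-- The covariance inequality for `[-1, 1]`-valued random variables. -/
lemma abs_integral_mul_sub_le_alphaDep (h𝒜 : 𝒜 ≤ m0) (hℬ : ℬ ≤ m0) {f g : Ω → ℝ}
    (hf : Measurable[𝒜] f) (hg : Measurable[ℬ] g) (f1 : ∀ ω, |f ω| ≤ 1) (g1 : ∀ ω, |g ω| ≤ 1) :
    |∫ ω, f ω * g ω ∂P - (∫ ω, f ω ∂P) * ∫ ω, g ω ∂P| ≤ 4 * alphaDep P 𝒜 ℬ := by
  have hf' : Measurable f := hf.mono h𝒜 le_rfl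
  have hg' : Measurable g := hg.mono hℬ le_rfl
  have hfi : Integrable f P := Integrable.of_bound hf'.aestronglyMeasurable 1 (ae_of_all _ f1)
  have hgi : Integrable g P := Integrable.of_bound hg'.aestronglyMeasurable 1 (ae_of_all _ g1)
  have hfg : Integrable (fun ω => f ω * g ω) P :=
    Integrable.of_bound (hf'.mul hg').aestronglyMeasurable 1 (ae_of_all _ fun ω => by
      rw [norm_mul]; exact mul_le_one₀ (f1 ω) (norm_nonneg _) (g1 ω))
  -- Mapping `[-1, 1]` onto `[0, 1]` by `x ↦ (x + 1) / 2` divides the covariance by `4`.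
  have key := abs_integral_mul_sub_le_alphaDep_of_mem_Icc (P := P) h𝒜 hℬ
    (f := fun ω => (f ω + 1) / 2) (g := fun ω => (g ω + 1) / 2)
    ((hf.add_const 1).div_const 2) ((hg.add_const 1).div_const 2)
    (fun ω => by linarith [(abs_le.1 (f1 ω)).1]) (fun ω => by linarith [(abs_le.1 (f1 ω)).2])
    (fun ω => by linarith [(abs_le.1 (g1 ω)).1]) (fun ω => by linarith [(abs_le.1 (g1 ω)).2])
  have e1 : ∫ ω, (f ω + 1) / 2 ∂P = (∫ ω, f ω ∂P + 1) / 2 := by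
    rw [integral_div, integral_add hfi (integrable_const _)]; simp
  have e2 : ∫ ω, (g ω + 1) / 2 ∂P = (∫ ω, g ω ∂P + 1) / 2 := by
    rw [integral_div, integral_add hgi (integrable_const _)]; simp
  have e3 : ∫ ω, (f ω + 1) / 2 * ((g ω + 1) / 2) ∂P
      = (∫ ω, f ω * g ω ∂P + ∫ ω, f ω ∂P + ∫ ω, g ω ∂P + 1) / 4 := by
    have : ∀ ω, (f ω + 1) / 2 * ((g ω + 1) / 2) = (f ω * g ω + f ω + g ω + 1) / 4 :=
      fun ω => by ring
    simp_rw [this]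
    have h2 : Integrable (fun ω => f ω * g ω + f ω) P := hfg.add hfi
    have h3 : Integrable (fun ω => f ω * g ω + f ω + g ω) P := h2.add hgi
    rw [integral_div, integral_add h3 (integrable_const _), integral_add h2 hgi,
      integral_add hfg hfi]
    simp
  rw [e1, e2, e3] at key
  rw [abs_le] at key ⊢
  constructor <;> nlinarith [key.1, key.2]

/-- The covariance inequality for complex random variables bounded by `1`. -/
lemma norm_integral_mul_sub_le_alphaDep (h𝒜 : 𝒜 ≤ m0) (hℬ : ℬ ≤ m0) {f g : Ω → ℂ}
    (hf : Measurable[𝒜] f) (hg : Measurable[ℬ] g) (f1 : ∀ ω, ‖f ω‖ ≤ 1) (g1 : ∀ ω, ‖g ω‖ ≤ 1) :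
    ‖∫ ω, f ω * g ω ∂P - (∫ ω, f ω ∂P) * ∫ ω, g ω ∂P‖ ≤ 16 * alphaDep P 𝒜 ℬ := by
  have hf' : Measurable f := hf.mono h𝒜 le_rfl
  have hg' : Measurable g := hg.mono hℬ le_rfl
  have hfi : Integrable f P := Integrable.of_bound hf'.aestronglyMeasurable 1 (ae_of_all _ f1)
  have hgi : Integrable g P := Integrable.of_bound hg'.aestronglyMeasurable 1 (ae_of_all _ g1)
  have hfg : Integrable (fun ω => f ω * g ω) P :=
    Integrable.of_bound (hf'.mul hg').aestronglyMeasurable 1 (ae_of_all _ fun ω => by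
      rw [norm_mul]; exact mul_le_one₀ (f1 ω) (norm_nonneg _) (g1 ω))
  have re_int {h : Ω → ℂ} (hh : Integrable h P) : (∫ ω, h ω ∂P).re = ∫ ω, (h ω).re ∂P :=
    (integral_re hh).symm
  have im_int {h : Ω → ℂ} (hh : Integrable h P) : (∫ ω, h ω ∂P).im = ∫ ω, (h ω).im ∂P :=
    (integral_im hh).symm
  have bd {u v : Ω → ℝ} (hu : Measurable[𝒜] u) (hv : Measurable[ℬ] v)
      (u1 : ∀ ω, |u ω| ≤ 1) (v1 : ∀ ω, |v ω| ≤ 1) : Integrable (fun ω => u ω * v ω) P :=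
    Integrable.of_bound ((hu.mono h𝒜 le_rfl).mul (hv.mono hℬ le_rfl)).aestronglyMeasurable 1
      (ae_of_all _ fun ω => by
        rw [norm_mul]; exact mul_le_one₀ (u1 ω) (norm_nonneg _) (v1 ω))
  have mfr : Measurable[𝒜] fun ω => (f ω).re := Complex.measurable_re.comp hf
  have mfi : Measurable[𝒜] fun ω => (f ω).im := Complex.measurable_im.comp hf
  have mgr : Measurable[ℬ] fun ω => (g ω).re := Complex.measurable_re.comp hg
  have mgi : Measurable[ℬ] fun ω => (g ω).im := Complex.measurable_im.comp hg
  have bfr ω : |(f ω).re| ≤ 1 := (Complex.abs_re_le_norm _).trans (f1 ω)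
  have bfi ω : |(f ω).im| ≤ 1 := (Complex.abs_im_le_norm _).trans (f1 ω)
  have bgr ω : |(g ω).re| ≤ 1 := (Complex.abs_re_le_norm _).trans (g1 ω)
  have bgi ω : |(g ω).im| ≤ 1 := (Complex.abs_im_le_norm _).trans (g1 ω)
  -- Real and imaginary parts of the complex covariance are each a combination of two real ones,
  -- whence `2 * 2 * 4 = 16`.
  have k1 := abs_integral_mul_sub_le_alphaDep (P := P) h𝒜 hℬ mfr mgr bfr bgr
  have k2 := abs_integral_mul_sub_le_alphaDep (P := P) h𝒜 hℬ mfr mgi bfr bgi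
  have k3 := abs_integral_mul_sub_le_alphaDep (P := P) h𝒜 hℬ mfi mgr bfi bgr
  have k4 := abs_integral_mul_sub_le_alphaDep (P := P) h𝒜 hℬ mfi mgi bfi bgi
  refine (Complex.norm_le_abs_re_add_abs_im _).trans ?_
  have hr : |(∫ ω, f ω * g ω ∂P - (∫ ω, f ω ∂P) * ∫ ω, g ω ∂P).re| ≤ 8 * alphaDep P 𝒜 ℬ := by
    rw [Complex.sub_re, Complex.mul_re, re_int hfg, re_int hfi, re_int hgi, im_int hfi, im_int hgi]
    simp_rw [Complex.mul_re]
    rw [integral_sub (bd mfr mgr bfr bgr) (bd mfi mgi bfi bgi)]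
    rw [abs_le] at k1 k4 ⊢
    constructor <;> linarith [k1.1, k1.2, k4.1, k4.2]
  have hi : |(∫ ω, f ω * g ω ∂P - (∫ ω, f ω ∂P) * ∫ ω, g ω ∂P).im| ≤ 8 * alphaDep P 𝒜 ℬ := by
    rw [Complex.sub_im, Complex.mul_im, im_int hfg, re_int hfi, re_int hgi, im_int hfi, im_int hgi]
    simp_rw [Complex.mul_im]
    rw [integral_add (bd mfr mgi bfr bgi) (bd mfi mgr bfi bgr)]
    rw [abs_le] at k2 k3 ⊢
    constructor <;> linarith [k2.1, k2.2, k3.1, k3.2]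
  linarith

end Covariance

/-! ### Asymptotic independence of consecutive blocks -/

section CharacteristicFunctions

variable {Ω E : Type*} {m0 : MeasurableSpace Ω} [NormedAddCommGroup E] [NormedSpace ℝ E]
  [MeasurableSpace E] [BorelSpace E]

/-- The partial sums `X_1 + ⋯ + X_n`. -/
def partialSum (X : ℕ → Ω → E) (n : ℕ) (ω : Ω) : E := ∑ k ∈ Finset.Icc 1 n, X k ω

omit [NormedSpace ℝ E] [MeasurableSpace E] [BorelSpace E] in
lemma partialSum_eq_add (X : ℕ → Ω → E) {m n : ℕ} (h : m ≤ n) (ω : Ω) :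
    partialSum X n ω = partialSum X m ω + ∑ k ∈ Finset.Ioc m n, X k ω := by
  have hIcc (k : ℕ) : Finset.Icc 1 k = Finset.Ioc 0 k := by ext; simp; omega
  rw [partialSum, partialSum, hIcc, hIcc, Finset.sum_Ioc_consecutive _ (Nat.zero_le m) h]

omit [NormedSpace ℝ E] in
lemma measurable_partialSum [SecondCountableTopology E] {X : ℕ → Ω → E}
    (hX : ∀ k : ℕ, 1 ≤ k → Measurable (X k)) (n : ℕ) : Measurable (partialSum X n) :=
  Finset.measurable_sum _ fun k hk => hX k (Finset.mem_Icc.1 hk).1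

lemma charFunDual_map_eq_integral {P : Measure Ω} {Z : Ω → E} (hZ : AEMeasurable Z P)
    (L : StrongDual ℝ E) :
    charFunDual (P.map Z) L = ∫ ω, Complex.exp (L (Z ω) * Complex.I) ∂P := by
  rw [charFunDual_apply, integral_map hZ]
  exact Measurable.aestronglyMeasurable (by fun_prop)

lemma norm_exp_ofReal_mul_I_sub_one_le (x : ℝ) : ‖Complex.exp (x * Complex.I) - 1‖ ≤ |x| := by
  simpa [mul_comm] using Real.norm_exp_I_mul_ofReal_sub_one_le (x := x)

/-- Subadditivity from `e^{i(a+b)} - 1 = e^{ia} (e^{ib} - 1) + (e^{ia} - 1)` with `|e^{ia}| = 1`. It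
bounds the effect of a gap by its individual summands. -/
lemma norm_exp_sum_mul_I_sub_one_le {ι : Type*} (s : Finset ι) (x : ι → ℝ) :
    ‖Complex.exp ((∑ j ∈ s, x j : ℝ) * Complex.I) - 1‖
      ≤ ∑ j ∈ s, ‖Complex.exp (x j * Complex.I) - 1‖ := by
  classical
  induction s using Finset.induction_on with
  | empty => simp
  | insert a s ha ih =>
    rw [Finset.sum_insert ha, Finset.sum_insert ha]
    have : Complex.exp ((x a + ∑ j ∈ s, x j : ℝ) * Complex.I) - 1
        = Complex.exp (x a * Complex.I)
          * (Complex.exp ((∑ j ∈ s, x j : ℝ) * Complex.I) - 1)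
          + (Complex.exp (x a * Complex.I) - 1) := by
      rw [Complex.ofReal_add, add_mul, Complex.exp_add]; ring
    rw [this]
    refine (norm_add_le _ _).trans ?_
    rw [norm_mul, Complex.norm_exp_ofReal_mul_I, one_mul, add_comm]
    gcongr

variable {P : Measure Ω} [IsProbabilityMeasure P]

lemma integral_norm_exp_sub_one_le {Y : Ω → E} (hY : Measurable Y) (L : StrongDual ℝ E) {δ : ℝ}
    (hδ : 0 ≤ δ) :
    ∫ ω, ‖Complex.exp (L (Y ω) * Complex.I) - 1‖ ∂P
      ≤ ‖L‖ * δ + 2 * P.real {ω | δ ≤ ‖Y ω‖} := by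
  have hs : MeasurableSet {ω | δ ≤ ‖Y ω‖} := measurableSet_le measurable_const hY.norm
  have hpt (ω : Ω) : ‖Complex.exp (L (Y ω) * Complex.I) - 1‖
      ≤ ‖L‖ * δ + {ω | δ ≤ ‖Y ω‖}.indicator (fun _ => (2 : ℝ)) ω := by
    by_cases h : δ ≤ ‖Y ω‖
    · rw [Set.indicator_of_mem (by exact h)]
      have : ‖Complex.exp (L (Y ω) * Complex.I) - 1‖ ≤ 2 := by
        refine (norm_sub_le _ _).trans ?_
        rw [Complex.norm_exp_ofReal_mul_I, norm_one]; norm_num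
      have : 0 ≤ ‖L‖ * δ := by positivity
      linarith
    · rw [Set.indicator_of_notMem (by exact h), add_zero]
      refine (norm_exp_ofReal_mul_I_sub_one_le _).trans ?_
      refine (L.le_opNorm _).trans ?_
      gcongr
      exact (not_le.1 h).le
  have hind : Integrable ({ω | δ ≤ ‖Y ω‖}.indicator fun _ => (2 : ℝ)) P :=
    (integrable_const _).indicator hs
  refine (integral_mono_of_nonneg (ae_of_all _ fun _ => norm_nonneg _)
    ((integrable_const _).add hind) (ae_of_all _ hpt)).trans ?_
  simp only [Pi.add_apply]
  rw [integral_add (integrable_const _) hind, integral_indicator_const _ hs]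
  simp [mul_comm]

variable {X : ℕ → Ω → E} {A : ℕ → E →L[ℝ] E}

/-- Along an infinitesimal array, the characteristic functions of the entries tend to `1`
uniformly over the rows and over bounded sets. -/
lemma IsInfinitesimal.exists_integral_norm_exp_sub_one_le
    (hX : ∀ k : ℕ, 1 ≤ k → Measurable (X k))
    (hinf : IsInfinitesimal P (fun n j ω => A n (X j ω))) {R ε : ℝ} (hR : 0 ≤ R) (hε : 0 < ε) :
    ∃ N : ℕ, ∀ n, N ≤ n → ∀ j, 1 ≤ j → j ≤ n → ∀ L : StrongDual ℝ E, ‖L‖ ≤ R →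
      ∫ ω, ‖Complex.exp (L (A n (X j ω)) * Complex.I) - 1‖ ∂P ≤ ε := by
  -- Both `‖L‖ δ` and twice the tail probability will be at most `ε / 2`; `R + 1` keeps the
  -- denominator positive when `R = 0`.
  have hδ : 0 < ε / (2 * (R + 1)) := by positivity
  have hev := (hinf _ hδ).eventually
    (gt_mem_nhds (show (0 : ℝ≥0∞) < ENNReal.ofReal (ε / 4) by simpa using by positivity))
  obtain ⟨N, hN⟩ := eventually_atTop.1 hev
  refine ⟨N, fun n hn j hj1 hjn L hL => ?_⟩
  refine (integral_norm_exp_sub_one_le ((A n).measurable.comp (hX j hj1)) L hδ.le).trans ?_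
  have h1 : P.real {ω | ε / (2 * (R + 1)) ≤ ‖A n (X j ω)‖} ≤ ε / 4 := by
    refine ENNReal.toReal_le_of_le_ofReal (by positivity) (le_trans ?_ (hN n hn).le)
    exact le_iSup₂ (f := fun j (_ : j ∈ Set.Icc 1 n) =>
      P {ω | ε / (2 * (R + 1)) ≤ ‖A n (X j ω)‖}) j ⟨hj1, hjn⟩
  have h2 : ‖L‖ * (ε / (2 * (R + 1))) ≤ ε / 2 := by
    calc ‖L‖ * (ε / (2 * (R + 1))) ≤ (R + 1) * (ε / (2 * (R + 1))) := by gcongr; linarith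
      _ = ε / 2 := by field_simp
  simp only [Function.comp_apply]
  linarith

/-- Approximate factorisation of an expectation across a gap `w` that is close to `1`. -/
lemma norm_integral_mul_mul_sub_le {𝒜 ℬ : MeasurableSpace Ω} {m0 : MeasurableSpace Ω}
    {P : Measure Ω} [IsProbabilityMeasure P] (h𝒜 : 𝒜 ≤ m0) (hℬ : ℬ ≤ m0) {f w g : Ω → ℂ}
    (hf : Measurable[𝒜] f) (hw : Measurable w) (hg : Measurable[ℬ] g) (f1 : ∀ ω, ‖f ω‖ ≤ 1)
    (w1 : ∀ ω, ‖w ω‖ ≤ 1) (g1 : ∀ ω, ‖g ω‖ ≤ 1) :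
    ‖∫ ω, f ω * (w ω * g ω) ∂P - (∫ ω, f ω ∂P) * ∫ ω, w ω * g ω ∂P‖
      ≤ 16 * alphaDep P 𝒜 ℬ + 2 * ∫ ω, ‖w ω - 1‖ ∂P := by
  have hf' : Measurable f := hf.mono h𝒜 le_rfl
  have hg' : Measurable g := hg.mono hℬ le_rfl
  have mul1 {a b : ℂ} (ha : ‖a‖ ≤ 1) (hb : ‖b‖ ≤ 1) : ‖a * b‖ ≤ 1 := by
    rw [norm_mul]; exact mul_le_one₀ ha (norm_nonneg _) hb
  have int1 {h : Ω → ℂ} (hh : Measurable h) (h1 : ∀ ω, ‖h ω‖ ≤ 1) : Integrable h P :=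
    Integrable.of_bound hh.aestronglyMeasurable 1 (ae_of_all _ h1)
  have hcov := norm_integral_mul_sub_le_alphaDep (P := P) h𝒜 hℬ hf hg f1 g1
  have hwi : Integrable (fun ω => ‖w ω - 1‖) P := ((int1 hw w1).sub (integrable_const 1)).norm
  -- The factor `w` is removed from the joint expectation and from the product of expectations, each
  -- time at cost `∫ ‖w - 1‖`.
  have hd1 : ‖∫ ω, f ω * (w ω * g ω) ∂P - ∫ ω, f ω * g ω ∂P‖ ≤ ∫ ω, ‖w ω - 1‖ ∂P := by
    have i1 : Integrable (fun ω => f ω * (w ω * g ω)) P :=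
      int1 (hf'.mul (hw.mul hg')) fun ω => mul1 (f1 ω) (mul1 (w1 ω) (g1 ω))
    have i2 : Integrable (fun ω => f ω * g ω) P := int1 (hf'.mul hg') fun ω => mul1 (f1 ω) (g1 ω)
    rw [← integral_sub i1 i2]
    refine norm_integral_le_of_norm_le hwi (ae_of_all _ fun ω => ?_)
    rw [show f ω * (w ω * g ω) - f ω * g ω = (f ω * g ω) * (w ω - 1) by ring, norm_mul]
    exact mul_le_of_le_one_left (norm_nonneg _) (mul1 (f1 ω) (g1 ω))
  have hd2 : ‖∫ ω, w ω * g ω ∂P - ∫ ω, g ω ∂P‖ ≤ ∫ ω, ‖w ω - 1‖ ∂P := by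
    have i1 : Integrable (fun ω => w ω * g ω) P := int1 (hw.mul hg') fun ω => mul1 (w1 ω) (g1 ω)
    rw [← integral_sub i1 (int1 hg' g1)]
    refine norm_integral_le_of_norm_le hwi (ae_of_all _ fun ω => ?_)
    rw [show w ω * g ω - g ω = g ω * (w ω - 1) by ring, norm_mul]
    exact mul_le_of_le_one_left (norm_nonneg _) (g1 ω)
  have hfint : ‖∫ ω, f ω ∂P‖ ≤ 1 := by
    simpa using norm_integral_le_of_norm_le_const (μ := P) (ae_of_all _ f1)
  have hd3 : ‖(∫ ω, f ω ∂P) * (∫ ω, w ω * g ω ∂P - ∫ ω, g ω ∂P)‖ ≤ ∫ ω, ‖w ω - 1‖ ∂P := by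
    rw [norm_mul]
    exact (mul_le_of_le_one_left (norm_nonneg _) hfint).trans hd2
  calc ‖∫ ω, f ω * (w ω * g ω) ∂P - (∫ ω, f ω ∂P) * ∫ ω, w ω * g ω ∂P‖
      = ‖(∫ ω, f ω * (w ω * g ω) ∂P - ∫ ω, f ω * g ω ∂P)
          + (∫ ω, f ω * g ω ∂P - (∫ ω, f ω ∂P) * ∫ ω, g ω ∂P)
          - (∫ ω, f ω ∂P) * (∫ ω, w ω * g ω ∂P - ∫ ω, g ω ∂P)‖ := by congr 1; ring
    _ ≤ _ := norm_sub_le _ _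
    _ ≤ (∫ ω, ‖w ω - 1‖ ∂P + 16 * alphaDep P 𝒜 ℬ) + ∫ ω, ‖w ω - 1‖ ∂P :=
        add_le_add ((norm_add_le _ _).trans (add_le_add hd1 hcov)) hd3
    _ = _ := by ring

omit [NormedSpace ℝ E] in
lemma measurable_finset_sum_sigmaGen [SecondCountableTopology E] (X : ℕ → Ω → E) {s : Finset ℕ}
    {t : Set ℕ} (hst : ∀ k ∈ s, k ∈ t) :
    Measurable[sigmaGen X t] fun ω => ∑ k ∈ s, X k ω := by
  refine @Finset.measurable_sum _ _ _ _ _ _ (sigmaGen X t) _ s fun k hk => ?_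
  exact (comap_measurable (X k)).mono
    (le_iSup₂ (f := fun k (_ : k ∈ t) => MeasurableSpace.comap (X k) inferInstance) k (hst k hk))
    le_rfl

omit [NormedAddCommGroup E] [NormedSpace ℝ E] [BorelSpace E] in
lemma sigmaGen_le {X : ℕ → Ω → E} {t : Set ℕ} (h : ∀ k ∈ t, Measurable (X k)) :
    sigmaGen X t ≤ m0 :=
  iSup₂_le fun k hk => (h k hk).comap_le

/-- For a strongly mixing sequence and an infinitesimal array, the normalised blocks
`X_1 + ⋯ + X_m` and `X_{m+1} + ⋯ + X_n` are asymptotically independent, uniformly in `m`. -/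
lemma StronglyMixing.exists_norm_charFunDual_sub_mul_le [SecondCountableTopology E]
    (hmix : StronglyMixing P X) (hX : ∀ k : ℕ, 1 ≤ k → Measurable (X k))
    (hinf : IsInfinitesimal P (fun n j ω => A n (X j ω))) {R ε : ℝ} (hR : 0 ≤ R) (hε : 0 < ε) :
    ∃ N : ℕ, ∀ n, N ≤ n → ∀ m, 1 ≤ m → m ≤ n → ∀ L : StrongDual ℝ E, ‖L‖ ≤ R →
      ‖∫ ω, Complex.exp (L (A n (partialSum X n ω)) * Complex.I) ∂P
        - (∫ ω, Complex.exp (L (A n (partialSum X m ω)) * Complex.I) ∂P)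
          * ∫ ω, Complex.exp (L (A n (partialSum X n ω - partialSum X m ω)) * Complex.I) ∂P‖
        ≤ ε := by
  -- The gap length is fixed first, so that `16 α(q) ≤ ε / 2`; then `N` makes each gap term at most
  -- `ε / (4 (q + 1))`, so the gap contributes at most `2 * ε / 4`.
  obtain ⟨q, hq⟩ := (hmix.eventually (gt_mem_nhds (show (0 : ℝ) < ε / 32 by positivity))).exists
  obtain ⟨N, hN⟩ := hinf.exists_integral_norm_exp_sub_one_le hX hR
    (show 0 < ε / (4 * (q + 1)) by positivity)
  refine ⟨N, fun n hn m hm hmn L hL => ?_⟩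
  -- `G` is the gap after `m`, with at most `q` terms; `T` is the separated tail, empty when `n < m
  -- + q`.
  let G := (Finset.Ioc m n).filter (· < m + q)
  let T := (Finset.Ioc m n).filter (¬ · < m + q)
  have hsplit (ω : Ω) : ∑ k ∈ Finset.Ioc m n, X k ω = ∑ k ∈ G, X k ω + ∑ k ∈ T, X k ω :=
    (Finset.sum_filter_add_sum_filter_not _ _ _).symm
  have hmemG : ∀ k ∈ G, 1 ≤ k ∧ k ≤ n := fun k hk => by
    have := Finset.mem_Ioc.1 (Finset.mem_filter.1 hk).1
    omega
  have hmemT : ∀ k ∈ T, k ∈ Set.Ici (m + q) := fun k hk => not_lt.1 (Finset.mem_filter.1 hk).2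
  have hcard : (G.card : ℝ) ≤ q := by
    have : G ⊆ Finset.Ioc m (m + q) := fun k hk => by
      have h1 := Finset.mem_Ioc.1 (Finset.mem_filter.1 hk).1
      have h2 := (Finset.mem_filter.1 hk).2
      rw [Finset.mem_Ioc]; omega
    have := Finset.card_le_card this
    rw [Nat.card_Ioc] at this
    exact_mod_cast (by omega : G.card ≤ q)
  let ch (Y : Ω → E) (ω : Ω) : ℂ := Complex.exp (L (A n (Y ω)) * Complex.I)
  have hchm {m' : MeasurableSpace Ω} {Y : Ω → E} (hY : Measurable[m'] Y) : Measurable[m'] (ch Y) :=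
    (show Measurable fun x : E => Complex.exp (L (A n x) * Complex.I) by fun_prop).comp hY
  have hch1 (Y : Ω → E) (ω : Ω) : ‖ch Y ω‖ ≤ 1 := (Complex.norm_exp_ofReal_mul_I _).le
  have hGm : Measurable fun ω => ∑ k ∈ G, X k ω :=
    Finset.measurable_sum _ fun k hk => hX k (hmemG k hk).1
  have key := norm_integral_mul_mul_sub_le (P := P)
    (sigmaGen_le (X := X) (t := Set.Icc 1 m) fun k hk => hX k hk.1)
    (sigmaGen_le (X := X) (t := Set.Ici (m + q)) fun k hk => hX k (by
      have : m + q ≤ k := hk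
      omega))
    (f := ch (partialSum X m)) (w := ch fun ω => ∑ k ∈ G, X k ω)
    (g := ch fun ω => ∑ k ∈ T, X k ω)
    (hchm (measurable_finset_sum_sigmaGen X fun k hk => by simpa using hk)) (hchm hGm)
    (hchm (measurable_finset_sum_sigmaGen X hmemT)) (hch1 _) (hch1 _) (hch1 _)
  have hα := alphaDep_le_alphaCoeff (P := P) X hm q
  have hw : ∫ ω, ‖ch (fun ω => ∑ k ∈ G, X k ω) ω - 1‖ ∂P ≤ ε / 4 := by
    have hint (k : ℕ) (hk : k ∈ G) :
        Integrable (fun ω => ‖Complex.exp (L (A n (X k ω)) * Complex.I) - 1‖) P :=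
      ((Integrable.of_bound (hchm (hX k (hmemG k hk).1)).aestronglyMeasurable 1
        (ae_of_all _ (hch1 _))).sub (integrable_const 1)).norm
    calc ∫ ω, ‖ch (fun ω => ∑ k ∈ G, X k ω) ω - 1‖ ∂P
        ≤ ∫ ω, ∑ k ∈ G, ‖Complex.exp (L (A n (X k ω)) * Complex.I) - 1‖ ∂P := by
          refine integral_mono_of_nonneg (ae_of_all _ fun _ => norm_nonneg _)
            (integrable_finsetSum _ hint) (ae_of_all _ fun ω => ?_)
          have := norm_exp_sum_mul_I_sub_one_le G fun k => L (A n (X k ω))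
          simpa only [ch, map_sum] using this
      _ = ∑ k ∈ G, ∫ ω, ‖Complex.exp (L (A n (X k ω)) * Complex.I) - 1‖ ∂P :=
          integral_finsetSum _ hint
      _ ≤ G.card • (ε / (4 * (q + 1))) :=
          Finset.sum_le_card_nsmul _ _ _ fun k hk => hN n hn k (hmemG k hk).1 (hmemG k hk).2 L hL
      _ ≤ (q + 1) * (ε / (4 * (q + 1))) := by
          rw [nsmul_eq_mul]; gcongr; linarith
      _ = ε / 4 := by field_simp
  have e1 (ω : Ω) : Complex.exp (L (A n (partialSum X n ω)) * Complex.I)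
      = ch (partialSum X m) ω * (ch (fun ω => ∑ k ∈ G, X k ω) ω
        * ch (fun ω => ∑ k ∈ T, X k ω) ω) := by
    simp only [ch]
    rw [partialSum_eq_add X hmn, hsplit, ← Complex.exp_add, ← Complex.exp_add]
    congr 1
    simp only [map_add, Complex.ofReal_add]
    ring
  have e2 (ω : Ω) : Complex.exp (L (A n (partialSum X n ω - partialSum X m ω)) * Complex.I)
      = ch (fun ω => ∑ k ∈ G, X k ω) ω * ch (fun ω => ∑ k ∈ T, X k ω) ω := by
    simp only [ch]
    rw [partialSum_eq_add X hmn, add_sub_cancel_left, hsplit, ← Complex.exp_add]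
    congr 1
    simp only [map_add, Complex.ofReal_add]
    ring
  simp_rw [e1, e2]
  refine key.trans ?_
  linarith

end CharacteristicFunctions

/-! ### Fullness in terms of characteristic functions -/

section Fullness

lemma ae_eq_zero_of_integral_exp_eq_one {Ω : Type*} {m0 : MeasurableSpace Ω} {P : Measure Ω}
    [IsProbabilityMeasure P] {T : Ω → ℝ} (hT : Measurable T)
    (h : ∀ t : ℝ, ∫ ω, Complex.exp ((t * T ω : ℝ) * Complex.I) ∂P = 1) : T =ᵐ[P] 0 := by
  have : IsProbabilityMeasure (P.map T) := Measure.isProbabilityMeasure_map hT.aemeasurable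
  have hdirac : P.map T = Measure.dirac 0 := by
    refine Measure.ext_of_charFun (funext fun t => ?_)
    rw [charFun_apply_real, charFun_dirac, integral_map hT.aemeasurable
      (Measurable.aestronglyMeasurable (by fun_prop))]
    simpa using h t
  have h0 : ∀ᵐ x ∂(P.map T), x = 0 := by
    rw [hdirac, ae_dirac_eq]; rfl
  exact ae_of_ae_map hT.aemeasurable h0

variable {E : Type*} [NormedAddCommGroup E] [NormedSpace ℝ E] [MeasurableSpace E] [BorelSpace E]
  [SecondCountableTopology E]

/-- Symmetrisation: `|φ(t L)|²` is the characteristic function of `L x - L y` under `μ ⊗ μ`. If it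
is identically `1`, then `L` is almost surely constant and the support lies in a translate of `ker
L`. -/
lemma IsFull.exists_norm_charFunDual_smul_ne_one {μ : Measure E} [IsProbabilityMeasure μ]
    (hμ : IsFull μ) {L : StrongDual ℝ E} (hL : L ≠ 0) :
    ∃ t : ℝ, ‖charFunDual μ (t • L)‖ ≠ 1 := by
  by_contra! h
  have hT : Measurable fun p : E × E => L p.1 - L p.2 := by fun_prop
  have h0 := ae_eq_zero_of_integral_exp_eq_one (P := μ.prod μ) hT fun t => by
    have e (p : E × E) : Complex.exp ((t * (L p.1 - L p.2) : ℝ) * Complex.I)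
        = Complex.exp ((t • L) p.1 * Complex.I) * Complex.exp ((-(t • L)) p.2 * Complex.I) := by
      rw [← Complex.exp_add]
      congr 1
      simp only [smul_apply, neg_apply, smul_eq_mul]
      push_cast
      ring
    simp_rw [e]
    rw [integral_prod_mul (fun x => Complex.exp ((t • L) x * Complex.I))
      fun x => Complex.exp ((-(t • L)) x * Complex.I)]
    have hconj : ∫ x, Complex.exp ((-(t • L)) x * Complex.I) ∂μ
        = (starRingEnd ℂ) (charFunDual μ (t • L)) := by
      rw [charFunDual_apply, ← integral_conj]
      congr 1 with x
      rw [← Complex.exp_conj]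
      simp
    rw [hconj, ← charFunDual_apply, Complex.mul_conj, Complex.normSq_eq_norm_sq, h t]
    simp
  have h1 : ∀ᵐ y ∂μ, ∀ᵐ x ∂μ, L x - L y = 0 := by
    have := Measure.ae_ae_of_ae_prod h0
    filter_upwards [this] with y hy
    filter_upwards [hy] with x hx
    have : L y - L x = 0 := hx
    linarith
  obtain ⟨y, hy⟩ := h1.exists
  let H : AffineSubspace ℝ E := AffineSubspace.mk' y (LinearMap.ker L.toLinearMap)
  have hmem (x : E) : x ∈ H ↔ L x - L y = 0 := by
    rw [AffineSubspace.mem_mk', vsub_eq_sub, LinearMap.mem_ker]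
    simp
  have hcl : IsClosed (H : Set E) := by
    have : (H : Set E) = {x | L x - L y = 0} := by ext x; exact hmem x
    rw [this]
    exact isClosed_eq (by fun_prop) continuous_const
  have htop := hμ H (Measure.support_subset_of_isClosed hcl (by
    filter_upwards [hy] with x hx using (hmem x).2 hx))
  refine hL (ContinuousLinearMap.ext fun x => ?_)
  have h2 := (hmem (x + y)).1 (htop ▸ AffineSubspace.mem_top ℝ E _)
  simpa using h2

end Fullness

/-! ### Convergence in distribution: characteristic functions and tightness -/

section Convergence

variable {Ω Ω' E : Type*} {m0 : MeasurableSpace Ω} {mΩ' : MeasurableSpace Ω'}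
  [NormedAddCommGroup E] [NormedSpace ℝ E] [FiniteDimensional ℝ E]
  [MeasurableSpace E] [BorelSpace E]

omit [FiniteDimensional ℝ E] in
lemma tendsto_charFunDual {ι : Type*} {l : Filter ι} {ρ : ι → ProbabilityMeasure E}
    {ρ' : ProbabilityMeasure E} (h : Tendsto ρ l (𝓝 ρ')) (L : StrongDual ℝ E) :
    Tendsto (fun i => charFunDual (ρ i : Measure E) L) l (𝓝 (charFunDual (ρ' : Measure E) L)) := by
  rw [ProbabilityMeasure.tendsto_iff_forall_integral_rclike_tendsto ℂ] at h
  exact h (BoundedContinuousFunction.ofNormedAddCommGroup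
    (fun x => Complex.exp (L x * Complex.I)) (by fun_prop) 1
    fun x => (Complex.norm_exp_ofReal_mul_I _).le)

variable {P : Measure Ω} [IsProbabilityMeasure P] {Q : Measure Ω'} [IsProbabilityMeasure Q]

/-- Under convergence in distribution, characteristic functions converge jointly with their
arguments. -/
lemma tendsto_charFunDual_prod_nhds {Z : ℕ → Ω → E} {Z' : Ω' → E}
    (h : TendstoInDistribution Z atTop Z' (fun _ => P) Q) (L : StrongDual ℝ E) :
    Tendsto (fun p : ℕ × StrongDual ℝ E => charFunDual (P.map (Z p.1)) p.2) (atTop ×ˢ 𝓝 L)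
      (𝓝 (charFunDual (Q.map Z') L)) := by
  borelize (StrongDual ℝ E)
  have h1 : TendstoInDistribution (fun p : ℕ × StrongDual ℝ E => Z p.1) (atTop ×ˢ 𝓝 L) Z'
      (fun _ => P) Q :=
    ⟨fun p => h.forall_aemeasurable p.1, h.aemeasurable_limit, h.tendsto.comp tendsto_fst⟩
  -- Slutsky's argument: the moving functional is a deterministic random element converging in
  -- measure, and evaluation `(x, L) ↦ L x` is continuous.
  have h2 : TendstoInMeasure P (fun (p : ℕ × StrongDual ℝ E) (_ : Ω) => p.2) (atTop ×ˢ 𝓝 L)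
      (fun _ => L) := by
    rw [tendstoInMeasure_iff_norm]
    intro ε hε
    refine tendsto_const_nhds.congr' ?_
    have : ∀ᶠ p : ℕ × StrongDual ℝ E in atTop ×ˢ 𝓝 L, dist p.2 L < ε :=
      tendsto_snd.eventually (Metric.ball_mem_nhds L hε)
    filter_upwards [this] with p hp
    rw [dist_eq_norm] at hp
    simp [not_le.2 hp]
  have h3 := h1.continuous_comp_prodMk_of_tendstoInMeasure_const
    (g := fun q : E × StrongDual ℝ E => q.2 q.1) (by fun_prop) h2 (fun _ => aemeasurable_const)
  have h4 := tendsto_charFunDual h3.tendsto (ContinuousLinearMap.id ℝ ℝ)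
  refine (h4.congr fun p => ?_).trans_eq ?_
  · rw [charFunDual_map_eq_integral (h.forall_aemeasurable p.1)]
    exact charFunDual_map_eq_integral (h3.forall_aemeasurable p) _
  · rw [charFunDual_map_eq_integral h.aemeasurable_limit]
    exact congrArg 𝓝 (charFunDual_map_eq_integral h3.aemeasurable_limit _)

/-- The laws of a sequence converging in distribution form a tight set. -/
lemma isTightMeasureSet_of_tendstoInDistribution {Z : ℕ → Ω → E} {Z' : Ω' → E}
    (h : TendstoInDistribution Z atTop Z' (fun _ => P) Q) :
    IsTightMeasureSet (Set.range fun n => P.map (Z n)) := by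
  let ρ (n : ℕ) : ProbabilityMeasure E :=
    ⟨P.map (Z n), Measure.isProbabilityMeasure_map (h.forall_aemeasurable n)⟩
  let ρ' : ProbabilityMeasure E :=
    ⟨Q.map Z', Measure.isProbabilityMeasure_map h.aemeasurable_limit⟩
  have ht : Tendsto ρ atTop (𝓝 ρ') := h.tendsto
  have hcl : IsCompact (closure (Set.range ρ)) :=
    ht.isCompact_insert_range.closure_of_subset (Set.subset_insert _ _)
  have hcE := FiniteDimensional.complete ℝ E
  refine (isTightMeasureSet_of_isCompact_closure hcl).subset ?_
  rintro _ ⟨n, rfl⟩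
  exact ⟨_, ⟨n, rfl⟩, rfl⟩

end Convergence

/-! ### Nondegeneracy, and the normalising operators tend to zero -/

section NormalisedSums

variable {Ω E : Type*} {m0 : MeasurableSpace Ω} [NormedAddCommGroup E] [NormedSpace ℝ E]
  [FiniteDimensional ℝ E] [MeasurableSpace E] [BorelSpace E]
  {P : Measure Ω} [IsProbabilityMeasure P] {μ : Measure E} [IsProbabilityMeasure μ]

/-- If `Z_n` converges in distribution to a full measure, then `Z_n` cannot become degenerate in
some directions. -/
lemma IsFull.not_forall_tendsto_norm_charFunDual {Z : ℕ → Ω → E} (hμ : IsFull μ)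
    (hZ : TendstoInDistribution Z atTop (id : E → E) (fun _ => P) μ) {ι : Type*}
    {U : Ultrafilter ι} {n : ι → ℕ} (hn : Tendsto n U atTop) {t : ι → StrongDual ℝ E}
    (ht : ∀ᶠ i in U, ‖t i‖ = 1) :
    ¬ ∀ R : ℝ, Tendsto (fun i => ‖charFunDual (P.map (Z (n i))) (R • t i)‖) U (𝓝 1) := by
  intro h
  have hproper : ProperSpace (StrongDual ℝ E) := FiniteDimensional.proper ℝ _
  obtain ⟨e, he, hte⟩ := (isCompact_sphere (0 : StrongDual ℝ E) 1).ultrafilter_le_nhds (U.map t)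
    (by
      rw [Ultrafilter.coe_map, le_principal_iff, mem_map]
      filter_upwards [ht] with i hi
      simpa using hi)
  have hte : Tendsto t U (𝓝 e) := hte
  have he0 : e ≠ 0 := by
    rintro rfl
    simp at he
  obtain ⟨R, hR⟩ := hμ.exists_norm_charFunDual_smul_ne_one he0
  have h1 := ((tendsto_charFunDual_prod_nhds hZ (R • e)).comp
    (hn.prodMk (hte.const_smul R))).norm
  rw [Measure.map_id] at h1
  exact hR (tendsto_nhds_unique h1 (h R))

variable {X : ℕ → Ω → E} {A : ℕ → E →L[ℝ] E} {b : ℕ → E}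

lemma continuous_charFunDual (ρ : Measure E) [IsProbabilityMeasure ρ] :
    Continuous (charFunDual ρ) := by
  have hproper : ProperSpace (StrongDual ℝ E) := FiniteDimensional.proper ℝ _
  simp_rw [funext (charFunDual_apply (μ := ρ))]
  refine continuous_of_dominated (bound := fun _ => 1)
    (fun L => Measurable.aestronglyMeasurable (by fun_prop))
    (fun L => ae_of_all _ fun x => (Complex.norm_exp_ofReal_mul_I _).le) (integrable_const _)
    (ae_of_all _ fun x => by fun_prop)

-- Shifts the scalar from the operator to the functional, so that infinitesimality of `A_n X_j`
-- applies to the normalised operators `‖A_n‖⁻¹ A_n`.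
omit [FiniteDimensional ℝ E] [IsProbabilityMeasure P] in
lemma charFunDual_map_smul_comp_smul {Y : Ω → E} (hY : Measurable Y) (t c : ℝ)
    (L : StrongDual ℝ E) (B : E →L[ℝ] E) :
    charFunDual (P.map Y) (t • (L ∘L (c • B))) = charFunDual (P.map (B ∘ Y)) ((t * c) • L) := by
  rw [charFunDual_map_eq_integral hY.aemeasurable,
    charFunDual_map_eq_integral (B.measurable.comp hY).aemeasurable]
  simp [mul_assoc]

omit [FiniteDimensional ℝ E] in
lemma norm_charFunDual_map_sub_one_le {Y : Ω → E} (hY : Measurable Y) (L : StrongDual ℝ E) :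
    ‖charFunDual (P.map Y) L - 1‖ ≤ ∫ ω, ‖Complex.exp (L (Y ω) * Complex.I) - 1‖ ∂P := by
  have hint : Integrable (fun ω => Complex.exp (L (Y ω) * Complex.I)) P :=
    Integrable.of_bound (Measurable.aestronglyMeasurable (by fun_prop)) 1
      (ae_of_all _ fun ω => (Complex.norm_exp_ofReal_mul_I _).le)
  have heq : charFunDual (P.map Y) L - 1 = ∫ ω, (Complex.exp (L (Y ω) * Complex.I) - 1) ∂P := by
    rw [charFunDual_map_eq_integral hY.aemeasurable, integral_sub hint (integrable_const _)]
    simp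
  rw [heq]
  exact norm_integral_le_integral_norm _

/-- The normalising operators of an infinitesimal array with a full limit tend to `0`. -/
lemma IsFull.tendsto_zero (hμ : IsFull μ) (hX : ∀ k : ℕ, 1 ≤ k → Measurable (X k))
    (hinf : IsInfinitesimal P (fun n j ω => A n (X j ω)))
    (hlim : TendstoInDistribution (fun n ω => A n (partialSum X n ω) + b n) atTop
      (id : E → E) (fun _ => P) μ)
    (hA : ∀ n : ℕ, 1 ≤ n → (A n).IsInvertible) : Tendsto A atTop (𝓝 0) := by
  by_contra hnot
  obtain ⟨ε, hε, hfreq⟩ : ∃ ε > 0, ∃ᶠ n in atTop, ε ≤ ‖A n‖ := by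
    rw [Metric.tendsto_nhds] at hnot
    push Not at hnot
    simpa using hnot
  have hne : (atTop ⊓ 𝓟 {n | ε ≤ ‖A n‖}).NeBot := frequently_mem_iff_neBot.1 hfreq
  obtain ⟨U, hU⟩ := Ultrafilter.exists_le (atTop ⊓ 𝓟 {n | ε ≤ ‖A n‖})
  have hUtop : (U : Filter ℕ) ≤ atTop := hU.trans inf_le_left
  have hUε : ∀ᶠ n in U, ε ≤ ‖A n‖ := hU (mem_inf_of_right (mem_principal_self _))
  have hproper : ProperSpace (E →L[ℝ] E) := FiniteDimensional.proper ℝ _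
  obtain ⟨C, hC, hUC⟩ := (isCompact_sphere (0 : E →L[ℝ] E) 1).ultrafilter_le_nhds
    (U.map fun n => ‖A n‖⁻¹ • A n) (by
      rw [Ultrafilter.coe_map, le_principal_iff, mem_map]
      filter_upwards [hUε] with n hn
      have : ‖A n‖ ≠ 0 := (hε.trans_le hn).ne'
      simp [norm_smul, this])
  have hUC : Tendsto (fun n => ‖A n‖⁻¹ • A n) U (𝓝 C) := hUC
  have hC0 : C ≠ 0 := by
    rintro rfl
    simp at hC
  obtain ⟨x, hx⟩ : ∃ x, C x ≠ 0 := by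
    by_contra! h
    exact hC0 (ContinuousLinearMap.ext h)
  obtain ⟨L, -, hL⟩ := exists_dual_vector'' ℝ (C x)
  -- This nonzero functional, built from a limit `C` of the normalised operators, turns out to
  -- annihilate every `X_j` almost surely.
  let e : StrongDual ℝ E := L ∘L C
  have he : e ≠ 0 := fun h => by
    have : L (C x) = 0 := DFunLike.congr_fun h x
    rw [hL] at this
    exact hx (by simpa using this)
  have hchar (j : ℕ) (hj : 1 ≤ j) (t : ℝ) : charFunDual (P.map (X j)) (t • e) = 1 := by
    have h1 : Tendsto (fun n => charFunDual (P.map (X j)) (t • (L ∘L (‖A n‖⁻¹ • A n)))) U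
        (𝓝 (charFunDual (P.map (X j)) (t • e))) := by
      have hcont : Continuous fun B : E →L[ℝ] E => L ∘L B := by fun_prop
      have hLC : Tendsto (fun n => L ∘L (‖A n‖⁻¹ • A n)) U (𝓝 e) := (hcont.tendsto C).comp hUC
      have := Measure.isProbabilityMeasure_map (μ := P) (hX j hj).aemeasurable
      exact ((continuous_charFunDual (P.map (X j))).tendsto (t • e)).comp (hLC.const_smul t)
    refine tendsto_nhds_unique h1 ?_
    rw [Metric.tendsto_nhds]
    intro η hη
    -- Since `‖A n‖ ≥ ε` along `U`, the functionals `(t / ‖A n‖) L` stay in a ball of radius `|t|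
    -- ε⁻¹ ‖L‖`.
    obtain ⟨N, hN⟩ := hinf.exists_integral_norm_exp_sub_one_le hX
      (show 0 ≤ |t| * ε⁻¹ * ‖L‖ by positivity) (half_pos hη)
    filter_upwards [hUε, hUtop (eventually_ge_atTop N), hUtop (eventually_ge_atTop j)]
      with n hnε hnN hnj
    have hbound := hN n hnN j hj hnj ((t * ‖A n‖⁻¹) • L) (by
      have hinv : ‖A n‖⁻¹ ≤ ε⁻¹ := inv_anti₀ hε hnε
      rw [norm_smul, norm_mul, norm_inv, norm_norm, Real.norm_eq_abs]
      exact mul_le_mul_of_nonneg_right (mul_le_mul_of_nonneg_left hinv (abs_nonneg t))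
        (norm_nonneg L))
    rw [dist_eq_norm, charFunDual_map_smul_comp_smul (hX j hj)]
    exact ((norm_charFunDual_map_sub_one_le ((A n).measurable.comp (hX j hj)) _).trans
      hbound).trans_lt (half_lt_self hη)
  have hXe (j : ℕ) (hj : 1 ≤ j) : ∀ᵐ ω ∂P, e (X j ω) = 0 := by
    refine ae_eq_zero_of_integral_exp_eq_one (e.measurable.comp (hX j hj)) fun t => ?_
    have := hchar j hj t
    rw [charFunDual_map_eq_integral (hX j hj).aemeasurable] at this
    simpa using this
  have hSe (n : ℕ) : ∀ᵐ ω ∂P, e (partialSum X n ω) = 0 := by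
    have : ∀ᵐ ω ∂P, ∀ j, 1 ≤ j → e (X j ω) = 0 :=
      ae_all_iff.2 fun j => eventually_imp_distrib_left.2 (hXe j)
    filter_upwards [this] with ω hω
    rw [partialSum, map_sum]
    exact Finset.sum_eq_zero fun k hk => hω k (Finset.mem_Icc.1 hk).1
  -- For `n ≥ 1`, `v n ∘ A n = e`, so `v n` is almost surely constant on the normalised sum and the
  -- modulus of its characteristic function along `v n` is exactly `1`.
  let v (n : ℕ) : StrongDual ℝ E := e ∘L (A n).inverse
  have hv (n : ℕ) (hn : 1 ≤ n) : v n ≠ 0 := fun h => he <| by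
    ext y
    have : v n (A n y) = 0 := by rw [h]; rfl
    simpa [v, (hA n hn).inverse_apply_self] using this
  have hone : ∀ᶠ n in (U : Filter ℕ), 1 ≤ n := hUtop (eventually_ge_atTop 1)
  refine hμ.not_forall_tendsto_norm_charFunDual hlim (U := U) (n := id) hUtop
    (t := fun n => ‖v n‖⁻¹ • v n) ?_ fun R => ?_
  · filter_upwards [hone] with n hn
    simp [norm_smul, hv n hn]
  · refine tendsto_const_nhds.congr' ?_
    filter_upwards [hone] with n hn
    rw [id, charFunDual_map_eq_integral (hlim.forall_aemeasurable n)]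
    have hae : ∀ᵐ ω ∂P, Complex.exp ((R • ‖v n‖⁻¹ • v n) (A n (partialSum X n ω) + b n)
        * Complex.I) = Complex.exp ((R • ‖v n‖⁻¹ • v n) (b n) * Complex.I) := by
      filter_upwards [hSe n] with ω hω
      have : v n (A n (partialSum X n ω)) = 0 := by
        simpa [v, (hA n hn).inverse_apply_self] using hω
      rw [map_add]
      congr 3
      simp [this]
    rw [integral_congr_ae hae, integral_const, probReal_univ, one_smul,
      Complex.norm_exp_ofReal_mul_I]

end NormalisedSums

/-- If `g` does not tend to infinity, its image ultrafilter contains a finite set and is therefore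
principal. -/
lemma tendsto_atTop_or_eventually_eq {ι : Type*} (U : Ultrafilter ι) (g : ι → ℕ) :
    Tendsto g U atTop ∨ ∃ k, ∀ᶠ i in U, g i = k := by
  by_cases h : Tendsto g U atTop
  · exact Or.inl h
  rw [tendsto_atTop] at h
  push Not at h
  obtain ⟨k, hk⟩ := h
  have hmem : Set.Iio k ∈ U.map g := by
    exact hk
  obtain ⟨c, -, hc⟩ := Ultrafilter.eq_pure_of_finite_mem (Set.finite_Iio k) hmem
  refine Or.inr ⟨c, ?_⟩
  have : {c} ∈ U.map g := by rw [hc]; exact Set.mem_singleton c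
  exact this

/-! ### Bounded quotients and decomposability of limit points -/

section Decomposability

variable {Ω E : Type*} {m0 : MeasurableSpace Ω} [NormedAddCommGroup E] [NormedSpace ℝ E]
  [MeasurableSpace E] [BorelSpace E]
  {P : Measure Ω} [IsProbabilityMeasure P] {μ : Measure E} [IsProbabilityMeasure μ]
  {X : ℕ → Ω → E} {A : ℕ → E →L[ℝ] E} {b : ℕ → E}

-- Take `x` in the unit ball with `‖D x‖ > ‖D‖ / 2` and a Hahn–Banach functional norming `D x`.
omit [MeasurableSpace E] [BorelSpace E] in
lemma exists_dual_le_norm_comp (D : E →L[ℝ] E) :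
    ∃ L : StrongDual ℝ E, ‖L‖ ≤ 1 ∧ ‖D‖ ≤ 2 * ‖L ∘L D‖ := by
  rcases eq_or_ne ‖D‖ 0 with h | h
  · exact ⟨0, by simp, by simp [h]⟩
  have hpos : 0 < ‖D‖ := lt_of_le_of_ne (norm_nonneg _) h.symm
  obtain ⟨x, hx1, hx⟩ := D.exists_lt_apply_of_lt_opNorm (half_lt_self hpos)
  obtain ⟨L, hL1, hL⟩ := exists_dual_vector'' ℝ (D x)
  refine ⟨L, hL1, ?_⟩
  have h1 := (L ∘L D).le_opNorm x
  have h2 : (L ∘L D) x = ‖D x‖ := hL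
  rw [h2, norm_norm] at h1
  have h3 : ‖L ∘L D‖ * ‖x‖ ≤ ‖L ∘L D‖ := mul_le_of_le_one_right (norm_nonneg _) hx1.le
  linarith

omit [MeasurableSpace E] [BorelSpace E] in
lemma tendsto_comp_const_zero (hA0 : Tendsto A atTop (𝓝 0)) (B : E →L[ℝ] E) :
    Tendsto (fun n => A n ∘L B) atTop (𝓝 0) := by
  have hcont : Continuous fun C : E →L[ℝ] E => C ∘L B := by fun_prop
  have := (hcont.tendsto 0).comp hA0
  rwa [ContinuousLinearMap.zero_comp] at this

/-- The law of the normalised sum `Z_n` is asymptotically the convolution of the law of `D Z_m`,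
`D = A_n A_m⁻¹`, with that of `Z_n - D Z_m`, uniformly in `m ≤ n`. -/
lemma StronglyMixing.exists_norm_charFunDual_sub_mul_charFunDual_le [SecondCountableTopology E]
    (hmix : StronglyMixing P X)
    (hX : ∀ k : ℕ, 1 ≤ k → Measurable (X k))
    (hinf : IsInfinitesimal P (fun n j ω => A n (X j ω)))
    (hA : ∀ n : ℕ, 1 ≤ n → (A n).IsInvertible) {R ε : ℝ} (hR : 0 ≤ R) (hε : 0 < ε) :
    ∃ N : ℕ, ∀ n, N ≤ n → ∀ m, 1 ≤ m → m ≤ n → ∀ L : StrongDual ℝ E, ‖L‖ ≤ R →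
      ‖charFunDual (P.map fun ω => A n (partialSum X n ω) + b n) L
        - charFunDual (P.map fun ω => A m (partialSum X m ω) + b m)
            (L ∘L (A n ∘L (A m).inverse))
          * charFunDual (P.map fun ω => A n (partialSum X n ω) + b n
              - (A n ∘L (A m).inverse) (A m (partialSum X m ω) + b m)) L‖ ≤ ε := by
  obtain ⟨N, hN⟩ := hmix.exists_norm_charFunDual_sub_mul_le hX hinf hR hε
  refine ⟨N, fun n hn m hm hmn L hL => ?_⟩
  have hS := measurable_partialSum hX
  have hSm := hS m
  have hSn := hS n
  have key := hN n hn m hm hmn L hL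
  rw [charFunDual_map_eq_integral (by fun_prop), charFunDual_map_eq_integral (by fun_prop),
    charFunDual_map_eq_integral (by fun_prop)]
  have hinv (y : E) : (A m).inverse (A m y) = y := (hA m hm).inverse_apply_self y
  have e1 (ω : Ω) : Complex.exp (L (A n (partialSum X n ω) + b n) * Complex.I)
      = Complex.exp (L (A n (partialSum X n ω)) * Complex.I)
        * Complex.exp (L (b n) * Complex.I) := by
    rw [← Complex.exp_add, map_add]; push_cast; congr 1; ring
  have e2 (ω : Ω) : Complex.exp ((L ∘L (A n ∘L (A m).inverse))
        (A m (partialSum X m ω) + b m) * Complex.I)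
      = Complex.exp (L (A n (partialSum X m ω)) * Complex.I)
        * Complex.exp (L (A n ((A m).inverse (b m))) * Complex.I) := by
    rw [← Complex.exp_add]
    simp only [ContinuousLinearMap.comp_apply, map_add, hinv]
    push_cast; congr 1; ring
  have e3 (ω : Ω) : Complex.exp (L (A n (partialSum X n ω) + b n
        - (A n ∘L (A m).inverse) (A m (partialSum X m ω) + b m)) * Complex.I)
      = Complex.exp (L (A n (partialSum X n ω - partialSum X m ω)) * Complex.I)
        * Complex.exp (L (b n - A n ((A m).inverse (b m))) * Complex.I) := by
    rw [← Complex.exp_add]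
    simp only [ContinuousLinearMap.comp_apply, map_add, map_sub, hinv]
    push_cast; congr 1; ring
  simp_rw [e1, e2, e3]
  rw [integral_mul_const, integral_mul_const, integral_mul_const]
  -- The shifts of the two factors recombine to that of `Z_n`, so a common factor of modulus `1`
  -- drops out of the estimate.
  have e4 : Complex.exp (L (A n ((A m).inverse (b m))) * Complex.I)
      * Complex.exp (L (b n - A n ((A m).inverse (b m))) * Complex.I)
      = Complex.exp (L (b n) * Complex.I) := by
    rw [← Complex.exp_add, map_sub]; push_cast; congr 1; ring
  rw [mul_mul_mul_comm, e4, ← sub_mul, norm_mul, Complex.norm_exp_ofReal_mul_I, mul_one]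
  exact key

lemma norm_charFunDual_map_le_one {Z : Ω → E} (hZ : AEMeasurable Z P) (L : StrongDual ℝ E) :
    ‖charFunDual (P.map Z) L‖ ≤ 1 := by
  rw [charFunDual_map_eq_integral hZ]
  simpa using norm_integral_le_of_norm_le_const (μ := P) (C := 1)
    (ae_of_all _ fun ω => (Complex.norm_exp_ofReal_mul_I (L (Z ω))).le)

variable [FiniteDimensional ℝ E]

lemma bddAbove_norm_comp_inverse
    (hX : ∀ k : ℕ, 1 ≤ k → Measurable (X k)) (hfull : IsFull μ) (hmix : StronglyMixing P X)
    (hinf : IsInfinitesimal P (fun n j ω => A n (X j ω)))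
    (hlim : TendstoInDistribution (fun n ω => A n (partialSum X n ω) + b n) atTop
      (id : E → E) (fun _ => P) μ)
    (hA : ∀ n : ℕ, 1 ≤ n → (A n).IsInvertible) :
    BddAbove {r : ℝ | ∃ n m : ℕ, 1 ≤ m ∧ m ≤ n ∧ r = ‖A n ∘L (A m).inverse‖} := by
  by_contra hnot
  rw [not_bddAbove_iff] at hnot
  let s : Set (ℕ × ℕ) := {p | 1 ≤ p.2 ∧ p.2 ≤ p.1}
  let D (p : ℕ × ℕ) : E →L[ℝ] E := A p.1 ∘L (A p.2).inverse
  have hne : (comap (fun p => ‖D p‖) atTop ⊓ 𝓟 s).NeBot := by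
    refine (((atTop_basis).comap _).inf_principal s).neBot_iff.2 fun {c} _ => ?_
    obtain ⟨_, ⟨n, m, hm, hmn, rfl⟩, hc⟩ := hnot c
    exact ⟨(n, m), hc.le, hm, hmn⟩
  obtain ⟨U, hU⟩ := Ultrafilter.exists_le (comap (fun p => ‖D p‖) atTop ⊓ 𝓟 s)
  have hD : Tendsto (fun p => ‖D p‖) U atTop := tendsto_iff_comap.2 (hU.trans inf_le_left)
  have hs : ∀ᶠ p in U, p ∈ s := hU (mem_inf_of_right (mem_principal_self _))
  have hA0 := hfull.tendsto_zero hX hinf hlim hA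
  -- If `n` were constant along `U`, so would be `m ≤ n`, and `‖D‖` could not diverge.
  have hn : Tendsto (fun p : ℕ × ℕ => p.1) U atTop := by
    refine (tendsto_atTop_or_eventually_eq U _).resolve_right ?_
    rintro ⟨k, hk⟩
    rcases tendsto_atTop_or_eventually_eq U fun p : ℕ × ℕ => p.2 with h | ⟨j, hj⟩
    · obtain ⟨p, hp, hps, hpk⟩ := ((h.eventually (eventually_gt_atTop k)).and (hs.and hk)).exists
      have := hps.2
      omega
    · refine not_tendsto_nhds_of_tendsto_atTop hD ‖D (k, j)‖ (tendsto_const_nhds.congr' ?_)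
      filter_upwards [hk, hj] with p hp1 hp2
      rw [← hp1, ← hp2]
  -- For constant `m`, `A_n → 0` would give `D → 0`.
  have hm : Tendsto (fun p : ℕ × ℕ => p.2) U atTop := by
    refine (tendsto_atTop_or_eventually_eq U _).resolve_right ?_
    rintro ⟨k, hk⟩
    refine not_tendsto_nhds_of_tendsto_atTop hD 0 ?_
    have h0 := ((tendsto_comp_const_zero hA0 (A k).inverse).comp hn).norm
    rw [norm_zero] at h0
    refine h0.congr' ?_
    filter_upwards [hk] with p hp
    simp only [Function.comp_apply, D, hp]
  choose L hL1 hL using fun p => exists_dual_le_norm_comp (D p)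
  let v (p : ℕ × ℕ) : StrongDual ℝ E := L p ∘L D p
  have hv : Tendsto (fun p => ‖v p‖) U atTop := by
    refine tendsto_atTop_mono (fun p => ?_) (hD.atTop_div_const (show (0 : ℝ) < 2 by norm_num))
    have := hL p
    simp only [v]
    linarith
  have hv0 : ∀ᶠ p in U, 0 < ‖v p‖ := hv.eventually (eventually_gt_atTop 0)
  refine hfull.not_forall_tendsto_norm_charFunDual hlim hm (t := fun p => ‖v p‖⁻¹ • v p) ?_ ?_
  · filter_upwards [hv0] with p hp
    rw [norm_smul, norm_inv, norm_norm, inv_mul_cancel₀ hp.ne']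
  intro R
  -- Scaled so that `u ∘ D` is `R` times the unit functional `v / ‖v‖`, while `‖u‖ ≤ |R| / ‖v‖ → 0`.
  let u (p : ℕ × ℕ) : StrongDual ℝ E := (R * ‖v p‖⁻¹) • L p
  have hu : Tendsto u U (𝓝 0) := by
    refine squeeze_zero_norm (a := fun p => |R| * ‖v p‖⁻¹) (fun p => ?_) ?_
    · rw [norm_smul, norm_mul, norm_inv, norm_norm, Real.norm_eq_abs]
      exact mul_le_of_le_one_right (by positivity) (hL1 p)
    · simpa using (tendsto_inv_atTop_zero.comp hv).const_mul |R|
  have hφ : Tendsto (fun p => ‖charFunDual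
      (P.map fun ω => A p.1 (partialSum X p.1 ω) + b p.1) (u p)‖) U (𝓝 1) := by
    have h1 := ((tendsto_charFunDual_prod_nhds hlim 0).comp (hn.prodMk hu)).norm
    rw [Measure.map_id] at h1
    simpa [charFunDual_apply, Function.comp_def] using h1
  rw [Metric.tendsto_nhds] at hφ ⊢
  intro ε hε
  obtain ⟨N, hN⟩ := hmix.exists_norm_charFunDual_sub_mul_charFunDual_le hX hinf hA (b := b)
    zero_le_one (half_pos hε)
  have hu1 : ∀ᶠ p in U, ‖u p‖ ≤ 1 := by
    have := hu.norm
    rw [norm_zero] at this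
    exact this.eventually_le_const one_pos
  filter_upwards [hs, hu1, hφ _ (half_pos hε), hn.eventually (eventually_ge_atTop N)]
    with p hps hpu hpφ hpN
  have key := hN p.1 hpN p.2 hps.1 hps.2 (u p) hpu
  have huv : u p ∘L (A p.1 ∘L (A p.2).inverse) = R • ‖v p‖⁻¹ • v p := by
    rw [smul_smul]
    exact ContinuousLinearMap.smul_comp _ _ _
  rw [huv] at key
  have hZn := hlim.forall_aemeasurable p.1
  have hZm := hlim.forall_aemeasurable p.2
  have b1 := norm_charFunDual_map_le_one hZm (R • ‖v p‖⁻¹ • v p)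
  have b2 := norm_charFunDual_map_le_one (P := P) (Z := fun ω =>
    A p.1 (partialSum X p.1 ω) + b p.1
      - (A p.1 ∘L (A p.2).inverse) (A p.2 (partialSum X p.2 ω) + b p.2)) (by fun_prop) (u p)
  -- Because `|ψ| ≤ 1`, the factorisation gives `|φ_n(u)| ≤ |φ_m(u ∘ D)| + ε / 2`; the left side is
  -- near `1`.
  have b3 := (norm_sub_norm_le _ _).trans key
  rw [norm_mul] at b3
  have b4 := mul_le_of_le_one_right (norm_nonneg (charFunDual
    (P.map fun ω => A p.2 (partialSum X p.2 ω) + b p.2) (R • ‖v p‖⁻¹ • v p))) b2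
  rw [Real.dist_eq, abs_lt] at hpφ ⊢
  constructor <;> linarith [hpφ.1]

omit [IsProbabilityMeasure P] in
/-- Differences `Z_n - D Z_m` of a tight sequence, with `D` bounded, are tight. -/
lemma isTightMeasureSet_sub {Z : ℕ → Ω → E} (hZ : ∀ n, AEMeasurable (Z n) P)
    (ht : IsTightMeasureSet (Set.range fun n => P.map (Z n))) {ι : Type*} (s : Set ι)
    (n m : ι → ℕ) (D : ι → E →L[ℝ] E) {C : ℝ} (hC : ∀ i ∈ s, ‖D i‖ ≤ C) :
    IsTightMeasureSet ((fun i => P.map fun ω => Z (n i) ω - D i (Z (m i) ω)) '' s) := by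
  have hproper : ProperSpace E := FiniteDimensional.proper ℝ E
  rw [isTightMeasureSet_iff_exists_isCompact_measure_compl_le] at ht ⊢
  intro ε hε
  obtain ⟨K, hK, hKε⟩ := ht (ε / 2) (ENNReal.half_pos hε.ne')
  obtain ⟨r, hr0, hr⟩ := hK.isBounded.exists_pos_norm_le
  refine ⟨Metric.closedBall 0 (r + C * r), isCompact_closedBall _ _, ?_⟩
  rintro _ ⟨i, hi, rfl⟩
  have hn := hZ (n i)
  have hm := hZ (m i)
  rw [Measure.map_apply_of_aemeasurable (by fun_prop) Metric.isClosed_closedBall.measurableSet.compl]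
  have hsub : (fun ω => Z (n i) ω - D i (Z (m i) ω)) ⁻¹' (Metric.closedBall 0 (r + C * r))ᶜ
      ⊆ Z (n i) ⁻¹' Kᶜ ∪ Z (m i) ⁻¹' Kᶜ := by
    intro ω hω
    by_contra h
    simp only [Set.mem_union, Set.mem_preimage, Set.mem_compl_iff, not_or, not_not] at h
    refine hω ?_
    rw [mem_closedBall_zero_iff]
    refine (norm_sub_le _ _).trans (add_le_add (hr _ h.1) ?_)
    refine ((D i).le_opNorm _).trans ?_
    exact mul_le_mul (hC i hi) (hr _ h.2) (norm_nonneg _) ((norm_nonneg _).trans (hC i hi))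
  have hbound (k : ℕ) : P (Z k ⁻¹' Kᶜ) ≤ ε / 2 := by
    rw [← Measure.map_apply_of_aemeasurable (hZ k) hK.measurableSet.compl]
    exact hKε _ ⟨k, rfl⟩
  calc _ ≤ P (Z (n i) ⁻¹' Kᶜ ∪ Z (m i) ⁻¹' Kᶜ) := measure_mono hsub
    _ ≤ _ := measure_union_le _ _
    _ ≤ ε / 2 + ε / 2 := add_le_add (hbound _) (hbound _)
    _ = ε := ENNReal.add_halves ε

omit [IsProbabilityMeasure P] [NormedSpace ℝ E] [FiniteDimensional ℝ E] in
/-- Prokhorov's theorem along an ultrafilter. -/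
lemma exists_tendsto_of_isTightMeasureSet {ι : Type*} {U : Ultrafilter ι}
    {ρ : ι → ProbabilityMeasure E} {s : Set ι} (hs : s ∈ U)
    (ht : IsTightMeasureSet ((fun i => (ρ i : Measure E)) '' s)) :
    ∃ ν : ProbabilityMeasure E, Tendsto ρ U (𝓝 ν) := by
  have hcl : IsCompact (closure (ρ '' s)) := by
    refine isCompact_closure_of_isTightMeasureSet (ht.subset ?_)
    rintro _ ⟨_, ⟨i, hi, rfl⟩, rfl⟩
    exact ⟨i, hi, rfl⟩
  obtain ⟨ν, -, hν⟩ := hcl.ultrafilter_le_nhds (U.map ρ) (by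
    rw [Ultrafilter.coe_map, le_principal_iff, mem_map]
    exact mem_of_superset hs fun i hi => subset_closure ⟨i, hi, rfl⟩)
  exact ⟨ν, hν⟩

omit [FiniteDimensional ℝ E] in
lemma zero_mem_decompSemigroup [SecondCountableTopology E] : (0 : E →L[ℝ] E) ∈ decompSemigroup μ := by
  refine ⟨μ, inferInstance, ?_⟩
  have : μ.map (0 : E →L[ℝ] E) = Measure.dirac 0 := by
    have := Measure.map_const μ (0 : E)
    rw [measure_univ, one_smul] at this
    exact this
  rw [this, Measure.dirac_zero_conv]

lemma mem_decompSemigroup_of_mapClusterPt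
    (hX : ∀ k : ℕ, 1 ≤ k → Measurable (X k)) (hfull : IsFull μ) (hmix : StronglyMixing P X)
    (hinf : IsInfinitesimal P (fun n j ω => A n (X j ω)))
    (hlim : TendstoInDistribution (fun n ω => A n (partialSum X n ω) + b n) atTop
      (id : E → E) (fun _ => P) μ)
    (hA : ∀ n : ℕ, 1 ≤ n → (A n).IsInvertible) {m : ℕ → ℕ}
    (hm : ∀ n : ℕ, 1 ≤ n → 1 ≤ m n ∧ m n ≤ n) {D : E →L[ℝ] E}
    (hD : MapClusterPt D atTop (fun n : ℕ => A n ∘L (A (m n)).inverse)) :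
    D ∈ decompSemigroup μ := by
  obtain ⟨U, hU, hUD⟩ := mapClusterPt_iff_ultrafilter.1 hD
  have hid : Tendsto (fun n : ℕ => n) U atTop := hU
  -- If `m` is constant along `U`, then `A_n → 0` forces `D = 0`, which is decomposable with
  -- cofactor `μ`.
  rcases tendsto_atTop_or_eventually_eq U m with hmU | ⟨k, hk⟩
  swap
  · have hA0 := hfull.tendsto_zero hX hinf hlim hA
    have h0 := (tendsto_comp_const_zero hA0 (A k).inverse).mono_left hU
    have : D = 0 := by
      refine tendsto_nhds_unique hUD (h0.congr' ?_)
      filter_upwards [hk] with n hn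
      rw [hn]
    rw [this]
    exact zero_mem_decompSemigroup
  let Z (n : ℕ) (ω : Ω) : E := A n (partialSum X n ω) + b n
  let Dn (n : ℕ) : E →L[ℝ] E := A n ∘L (A (m n)).inverse
  have hZ (n : ℕ) : AEMeasurable (Z n) P := hlim.forall_aemeasurable n
  have hY (n : ℕ) : AEMeasurable (fun ω => Z n ω - Dn n (Z (m n) ω)) P := by
    have h1 := hZ n
    have h2 := hZ (m n)
    fun_prop
  let ρ (n : ℕ) : ProbabilityMeasure E :=
    ⟨P.map fun ω => Z n ω - Dn n (Z (m n) ω), Measure.isProbabilityMeasure_map (hY n)⟩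
  have hs : {n | ‖Dn n‖ ≤ ‖D‖ + 1} ∈ U :=
    (hUD.norm.eventually_le_const (lt_add_one ‖D‖) : ∀ᶠ n in U, ‖Dn n‖ ≤ ‖D‖ + 1)
  -- The cofactor `ν` is a weak limit of the laws of `Z_n - D_n Z_m`, tight on the set where `‖D_n‖
  -- ≤ ‖D‖ + 1`.
  obtain ⟨ν, hν⟩ := exists_tendsto_of_isTightMeasureSet (ρ := ρ) hs
    (isTightMeasureSet_sub hZ (isTightMeasureSet_of_tendstoInDistribution hlim) _ id m Dn
      fun _ hi => hi)
  refine ⟨ν, inferInstance, ?_⟩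
  have hcE := FiniteDimensional.complete ℝ E
  have := Measure.isProbabilityMeasure_map (μ := μ) D.measurable.aemeasurable
  refine Measure.ext_of_charFunDual (funext fun L => ?_)
  rw [charFunDual_conv, charFunDual_map]
  have t1 : Tendsto (fun n => charFunDual (P.map (Z n)) L) U (𝓝 (charFunDual μ L)) := by
    have := (tendsto_charFunDual_prod_nhds hlim L).comp
      (hid.prodMk (tendsto_const_nhds (x := L)))
    rwa [Measure.map_id] at this
  have t2 : Tendsto (fun n => charFunDual (P.map (Z (m n))) (L ∘L Dn n)) U
      (𝓝 (charFunDual μ (L ∘L D))) := by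
    have hcont : Continuous fun B : E →L[ℝ] E => L ∘L B := by fun_prop
    have hLD : Tendsto (fun n => L ∘L Dn n) U (𝓝 (L ∘L D)) := (hcont.tendsto D).comp hUD
    have := (tendsto_charFunDual_prod_nhds hlim (L ∘L D)).comp (hmU.prodMk hLD)
    rwa [Measure.map_id] at this
  have t3 := tendsto_charFunDual hν L
  have t4 := t1.sub (t2.mul t3)
  have t5 : Tendsto (fun n => charFunDual (P.map (Z n)) L
      - charFunDual (P.map (Z (m n))) (L ∘L Dn n) * charFunDual (ρ n : Measure E) L) U (𝓝 0) := by
    rw [Metric.tendsto_nhds]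
    intro ε hε
    obtain ⟨N, hN⟩ := hmix.exists_norm_charFunDual_sub_mul_charFunDual_le hX hinf hA (b := b)
      (norm_nonneg L) (half_pos hε)
    filter_upwards [hid.eventually (eventually_ge_atTop N), hid.eventually (eventually_ge_atTop 1)]
      with n hn hn1
    rw [dist_zero_right]
    exact (hN n hn (m n) (hm n hn1).1 (hm n hn1).2 L le_rfl).trans_lt (half_lt_self hε)
  exact sub_eq_zero.1 (tendsto_nhds_unique t4 t5)

end Decomposability

end OpSelfdec

theorem proposition2 {d : ℕ} {Ω : Type*} [MeasurableSpace Ω]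
    (P : Measure Ω) [IsProbabilityMeasure P]
    (X : ℕ → Ω → EuclideanSpace ℝ (Fin d))
    (hX : ∀ k : ℕ, 1 ≤ k → Measurable (X k))
    (A : ℕ → EuclideanSpace ℝ (Fin d) →L[ℝ] EuclideanSpace ℝ (Fin d))
    (b : ℕ → EuclideanSpace ℝ (Fin d))
    (μ : Measure (EuclideanSpace ℝ (Fin d))) [IsProbabilityMeasure μ]
    (hfull : OpSelfdec.IsFull μ)
    (hmix : OpSelfdec.StronglyMixing P X)
    (hinf : OpSelfdec.IsInfinitesimal P (fun n j ω => A n (X j ω)))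
    (hlim : TendstoInDistribution
      (fun (n : ℕ) (ω : Ω) => A n (∑ k ∈ Finset.Icc 1 n, X k ω) + b n) atTop
      (id : EuclideanSpace ℝ (Fin d) → EuclideanSpace ℝ (Fin d)) (fun _ => P) μ)
    (hA : ∀ n : ℕ, 1 ≤ n → (A n).IsInvertible) :
    BddAbove {r : ℝ | ∃ n m : ℕ, 1 ≤ m ∧ m ≤ n ∧ r = ‖A n ∘L (A m).inverse‖} ∧
    ∀ m : ℕ → ℕ, (∀ n : ℕ, 1 ≤ n → 1 ≤ m n ∧ m n ≤ n) →
      ∀ D : EuclideanSpace ℝ (Fin d) →L[ℝ] EuclideanSpace ℝ (Fin d),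
        MapClusterPt D atTop (fun n : ℕ => A n ∘L (A (m n)).inverse) →
        D ∈ OpSelfdec.decompSemigroup μ := by
  exact ⟨OpSelfdec.bddAbove_norm_comp_inverse hX hfull hmix hinf hlim hA,
    fun m hm D hD =>
      OpSelfdec.mem_decompSemigroup_of_mapClusterPt hX hfull hmix hinf hlim hA hm hD⟩
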